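/- Let $\mathbb{H}=\{z\in\mathbb{C}:\operatorname{Im} z>0\}$ and let $f\colon\mathbb{H}\to\mathbb{H}$ be a holomorphic map that is parabolic with Denjoy--Wolff point at infinity; that is, $f$ has no fixed point in $\mathbb{H}$, the iterates $f^n$ tend to $\infty$ uniformly on compact subsets of $\mathbb{H}$, and $f(z)/z\to 1$ as $z\to\infty$ non-tangentially, i.e. as $|z|\to\infty$ within each sector $\{z\in\mathbb{H}:|\operatorname{Re} z|\le M\operatorname{Im} z\}$, $M>0$. Assume that $f$ is of finite shift, i.e. that there is $z_0\in\mathbb{H}$ with $\sup_n \operatorname{Im} f^n(z_0)<+\infty$. Let $$f(z)=\alpha z+\beta+\int_{\mathbb{R}}\frac{1+tz}{t-z}\,d\mu(t),\qquad z\in\mathbb{H},$$ be the Herglotz representation of $f$, where $\alpha\ge 0$, $\beta\in\mathbb{R}$ and $\mu$ is a finite positive Borel measure on $\mathbb{R}$. Then $\int_{\mathbb{R}}|t|\,d\mu(t)<+\infty$ and $$\frac{f^n}{n}\longrightarrow \beta-\int_{\mathbb{R}}t\,d\mu(t),\qquad n\to+\infty,$$ uniformly on compact subsets of $\mathbb{H}$.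 -/

import Mathlib

open Filter Topology MeasureTheory
open scoped UpperHalfPlane Manifold ContDiff

/-- `g` has angular (non-tangential) limit `l` at infinity in the upper half-plane: `g z` tends
to `l` as `|z| → ∞` inside each sector `{z : |Re z| ≤ M * Im z}`. -/
def HasAngularLimitAtInfty (g : ℍ → ℂ) (l : ℂ) : Prop :=
  ∀ M : ℝ, Tendsto g
    (comap (fun z : ℍ => ‖(z : ℂ)‖) atTop ⊓ 𝓟 {z : ℍ | |z.re| ≤ M * z.im}) (𝓝 l)

/-- The iterates of `f` tend to infinity uniformly on compact subsets of the upper half-plane,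
i.e. infinity is the Denjoy-Wolff point of the (non-elliptic) map `f`. -/
def HasDenjoyWolffPointInfty (f : ℍ → ℍ) : Prop :=
  ∀ K : Set ℍ, IsCompact K → ∀ R : ℝ, ∀ᶠ n : ℕ in atTop, ∀ z ∈ K, R < ‖((f^[n] z : ℍ) : ℂ)‖

/-- `f` is a parabolic holomorphic self-map of the upper half-plane with Denjoy-Wolff point at
infinity: it is non-elliptic (no fixed points), its iterates tend to infinity, and the angular
limit of `f z / z` at infinity is `1`. -/
structure IsParabolicAtInfty (f : ℍ → ℍ) : Prop where
  holomorphic : MDifferentiable 𝓘(ℂ) 𝓘(ℂ) f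
  nonelliptic : ∀ z : ℍ, f z ≠ z
  denjoyWolff : HasDenjoyWolffPointInfty f
  angularLimit : HasAngularLimitAtInfty (fun z : ℍ => (f z : ℂ) / (z : ℂ)) 1

/-- `f` is of finite shift: some orbit has bounded imaginary parts. -/
def IsFiniteShift (f : ℍ → ℍ) : Prop :=
  ∃ z₀ : ℍ, BddAbove (Set.range fun n : ℕ => (f^[n] z₀).im)

/-- `f z = α z + β + ∫ (1 + t z) / (t - z) dμ(t)` on the upper half-plane, with `α ≥ 0`, `β` real
and `μ` a finite positive measure on the real line: the Herglotz representation of `f`. -/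
structure IsHerglotzRepresentation (f : ℍ → ℍ) (α β : ℝ) (μ : Measure ℝ) : Prop where
  nonneg : 0 ≤ α
  finite : IsFiniteMeasure μ
  formula : ∀ z : ℍ, (f z : ℂ) =
    α * (z : ℂ) + β + ∫ t : ℝ, (1 + (t : ℂ) * (z : ℂ)) / ((t : ℂ) - (z : ℂ)) ∂μ

/-! The angular limit forces `α = 1`, so `Im f(z) = Im z * (1 + ∫ herglotzKernel z)` and imaginary
parts increase along orbits. On an orbit `w_n` with bounded imaginary parts the integrals of
`herglotzKernel w_n` are therefore summable (`sum_integral_kernel_le`). By Schwarz-Pick the steps of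
`w_n` are bounded, and `|w_n| → ∞`, so `Re w_n` tends to infinity with a fixed sign `ε`. Such a
sequence leaves no large gaps, hence the summed kernels dominate `|t|` and the square of the
positive part of `ε t` (`exists_le_sum_kernel`), and both are `μ`-integrable.

Writing `(1 + t z)/(t - z) = -t + (1 + t²)/(t - z)`, dominated convergence kills the last term along
`w_n`, so `w_{n+1} - w_n → β - ∫ t dμ`. Cesàro averaging gives the limit of `w_n / n`. Schwarz-Pick
keeps the orbits starting in a compact set within bounded distance of `w_n`, which gives uniformity.
-/

/-- The kernel `(1 + t²) / |t - z|²` of the imaginary part of a Herglotz representation. -/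
noncomputable def herglotzKernel (z : ℍ) (t : ℝ) : ℝ :=
  (1 + t ^ 2) / ((t - z.re) ^ 2 + z.im ^ 2)

lemma kernel_denom_pos (z : ℍ) (t : ℝ) : 0 < (t - z.re) ^ 2 + z.im ^ 2 := by
  have := z.im_pos
  positivity

lemma herglotzKernel_nonneg (z : ℍ) (t : ℝ) : 0 ≤ herglotzKernel z t :=
  div_nonneg (by positivity) (kernel_denom_pos z t).le

lemma continuous_herglotzKernel (z : ℍ) : Continuous (herglotzKernel z) :=
  Continuous.div (by fun_prop) (by fun_prop) fun t => (kernel_denom_pos z t).ne'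

lemma normSq_ofReal_sub (z : ℍ) (t : ℝ) :
    Complex.normSq ((t : ℂ) - z) = (t - z.re) ^ 2 + z.im ^ 2 := by
  rw [Complex.normSq_apply]
  simp [sq]

lemma norm_ofReal_sub_sq (z : ℍ) (t : ℝ) :
    ‖(t : ℂ) - z‖ ^ 2 = (t - z.re) ^ 2 + z.im ^ 2 := by
  rw [← normSq_ofReal_sub, Complex.normSq_eq_norm_sq]

lemma im_le_norm_ofReal_sub (z : ℍ) (t : ℝ) : z.im ≤ ‖(t : ℂ) - z‖ := by
  have h := Complex.abs_im_le_norm ((t : ℂ) - z)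
  simp only [Complex.sub_im, Complex.ofReal_im, UpperHalfPlane.coe_im, zero_sub, abs_neg] at h
  exact (le_abs_self _).trans h

lemma ofReal_sub_ne_zero (z : ℍ) (t : ℝ) : (t : ℂ) - z ≠ 0 :=
  norm_pos_iff.1 (z.im_pos.trans_le (im_le_norm_ofReal_sub z t))

lemma continuous_herglotz_integrand (z : ℍ) :
    Continuous fun t : ℝ => (1 + (t : ℂ) * (z : ℂ)) / ((t : ℂ) - (z : ℂ)) :=
  Continuous.div (by fun_prop) (by fun_prop) fun t => ofReal_sub_ne_zero z t

lemma integrable_herglotz_integrand (z : ℍ) (μ : Measure ℝ) [IsFiniteMeasure μ] :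
    Integrable (fun t : ℝ => (1 + (t : ℂ) * (z : ℂ)) / ((t : ℂ) - (z : ℂ))) μ := by
  refine Integrable.of_bound (continuous_herglotz_integrand z).aestronglyMeasurable
    (‖(z : ℂ)‖ + ‖1 + (z : ℂ) ^ 2‖ / z.im) (Eventually.of_forall fun t => ?_)
  have h0 := ofReal_sub_ne_zero z t
  have h : (1 + (t : ℂ) * z) / (t - z) = z + (1 + (z : ℂ) ^ 2) / (t - z) := by
    field_simp
    ring
  rw [h]
  refine (norm_add_le _ _).trans ?_
  rw [norm_div]
  gcongr
  exact im_le_norm_ofReal_sub z t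

lemma im_herglotz_integrand (z : ℍ) (t : ℝ) :
    ((1 + (t : ℂ) * (z : ℂ)) / ((t : ℂ) - (z : ℂ))).im = z.im * herglotzKernel z t := by
  have h0 := (kernel_denom_pos z t).ne'
  rw [Complex.div_im, normSq_ofReal_sub, herglotzKernel]
  simp
  field_simp
  ring

lemma integrable_herglotzKernel (z : ℍ) (μ : Measure ℝ) [IsFiniteMeasure μ] :
    Integrable (herglotzKernel z) μ := by
  have h := ((integrable_herglotz_integrand z μ).im).const_mul (z.im)⁻¹
  refine h.congr (Eventually.of_forall fun t => ?_)
  have := z.im_pos.ne'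
  change z.im⁻¹ * ((1 + (t : ℂ) * (z : ℂ)) / ((t : ℂ) - (z : ℂ))).im = _
  rw [im_herglotz_integrand]
  field_simp

/-! ### Schwarz-Pick and the linear coefficient, from the integral representation. -/

namespace IsHerglotzRepresentation

variable {f : ℍ → ℍ} {α β : ℝ} {μ : Measure ℝ}

lemma im_eq (h : IsHerglotzRepresentation f α β μ) (z : ℍ) :
    (f z).im = z.im * (α + ∫ t, herglotzKernel z t ∂μ) := by
  have := h.finite
  have h1 : (∫ t : ℝ, (1 + (t : ℂ) * (z : ℂ)) / ((t : ℂ) - (z : ℂ)) ∂μ).im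
      = z.im * ∫ t, herglotzKernel z t ∂μ := by
    have h2 := integral_im (integrable_herglotz_integrand z μ)
    simp only [RCLike.im_to_complex] at h2
    rw [← h2, ← integral_const_mul]
    simp_rw [im_herglotz_integrand]
  rw [← UpperHalfPlane.coe_im (f z), h.formula z]
  simp [h1]
  ring

/-- The difference of the integrands at `z` and `w` factors as `(z - w)(1 + t²)/((t - z)(t - w))`.
-/
lemma norm_sub_le (h : IsHerglotzRepresentation f α β μ) (z w : ℍ) :
    ‖(f z : ℂ) - f w‖ ≤ ‖(z : ℂ) - w‖ *
      (α + ∫ t : ℝ, (1 + t ^ 2) / (‖(t : ℂ) - z‖ * ‖(t : ℂ) - w‖) ∂μ) := by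
  have := h.finite
  have h1 : (f z : ℂ) - f w = (z - w) *
      (α + ∫ t : ℝ, (1 + (t : ℂ) ^ 2) / (((t : ℂ) - z) * ((t : ℂ) - w)) ∂μ) := by
    rw [h.formula z, h.formula w, mul_add, ← integral_const_mul]
    have h2 : ∀ t : ℝ, ((z : ℂ) - w) * ((1 + (t : ℂ) ^ 2) / (((t : ℂ) - z) * ((t : ℂ) - w)))
        = (1 + (t : ℂ) * z) / (t - z) - (1 + (t : ℂ) * w) / (t - w) := fun t => by
      have hz := ofReal_sub_ne_zero z t
      have hw := ofReal_sub_ne_zero w t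
      field_simp
      ring
    simp_rw [h2]
    rw [integral_sub (integrable_herglotz_integrand z μ) (integrable_herglotz_integrand w μ)]
    ring
  rw [h1, norm_mul]
  gcongr
  refine (norm_add_le _ _).trans ?_
  gcongr
  · simp [abs_of_nonneg h.nonneg]
  · refine (norm_integral_le_integral_norm _).trans_eq ?_
    congr 1 with t
    rw [norm_div, norm_mul]
    congr 1
    have : (1 + (t : ℂ) ^ 2) = ((1 + t ^ 2 : ℝ) : ℂ) := by push_cast; rfl
    rw [this, Complex.norm_real, Real.norm_of_nonneg (by positivity)]

/-- The invariant form of the Schwarz-Pick inequality. -/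
lemma schwarzPick (h : IsHerglotzRepresentation f α β μ) (z w : ℍ) :
    ‖(f z : ℂ) - f w‖ ^ 2 / ((f z).im * (f w).im) ≤ ‖(z : ℂ) - w‖ ^ 2 / (z.im * w.im) := by
  have := h.finite
  set A := α + ∫ t, herglotzKernel z t ∂μ with hA
  set B := α + ∫ t, herglotzKernel w t ∂μ with hB
  have hzi := h.im_eq z
  have hwi := h.im_eq w
  rw [← hA] at hzi
  rw [← hB] at hwi
  have hz := z.im_pos
  have hw := w.im_pos
  have hA0 : 0 < A := pos_of_mul_pos_right (hzi ▸ (f z).im_pos) hz.le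
  have hB0 : 0 < B := pos_of_mul_pos_right (hwi ▸ (f w).im_pos) hw.le
  set C := α + ∫ t : ℝ, (1 + t ^ 2) / (‖(t : ℂ) - z‖ * ‖(t : ℂ) - w‖) ∂μ with hC
  have hC0 : 0 ≤ C := add_nonneg h.nonneg (integral_nonneg fun t => by positivity)
  -- Cauchy-Schwarz `C² ≤ A B` in AM-GM form: a weighted inequality for every `r`, used below with
  -- `r = C / A`.
  have key : ∀ r : ℝ, 0 < r → 2 * C ≤ r * A + r⁻¹ * B := fun r hr => by
    have e1 : r * A + r⁻¹ * B - 2 * C = (r + r⁻¹ - 2) * α + ((∫ t, (r * herglotzKernel z t +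
        r⁻¹ * herglotzKernel w t) ∂μ) - ∫ t : ℝ, 2 * ((1 + t ^ 2) /
          (‖(t : ℂ) - z‖ * ‖(t : ℂ) - w‖)) ∂μ) := by
      rw [integral_add ((integrable_herglotzKernel z μ).const_mul r)
        ((integrable_herglotzKernel w μ).const_mul r⁻¹), integral_const_mul, integral_const_mul,
        integral_const_mul, hA, hB, hC]
      ring
    have e2 : 0 ≤ r + r⁻¹ - 2 := by
      have : r + r⁻¹ - 2 = (r - 1) ^ 2 / r := by field_simp; ring
      rw [this]; positivity
    have e3 : (∫ t : ℝ, 2 * ((1 + t ^ 2) / (‖(t : ℂ) - z‖ * ‖(t : ℂ) - w‖)) ∂μ) ≤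
        ∫ t, (r * herglotzKernel z t + r⁻¹ * herglotzKernel w t) ∂μ := by
      refine integral_mono_of_nonneg (Eventually.of_forall fun t => by positivity)
        (((integrable_herglotzKernel z μ).const_mul r).add
        ((integrable_herglotzKernel w μ).const_mul r⁻¹)) (Eventually.of_forall fun t => ?_)
      have hz0 : 0 < ‖(t : ℂ) - z‖ := norm_pos_iff.2 (ofReal_sub_ne_zero z t)
      have hw0 : 0 < ‖(t : ℂ) - w‖ := norm_pos_iff.2 (ofReal_sub_ne_zero w t)
      simp only [herglotzKernel, ← norm_ofReal_sub_sq]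
      set a := ‖(t : ℂ) - z‖
      set b := ‖(t : ℂ) - w‖
      have : r * ((1 + t ^ 2) / a ^ 2) + r⁻¹ * ((1 + t ^ 2) / b ^ 2)
          - 2 * ((1 + t ^ 2) / (a * b)) = (1 + t ^ 2) / r * (r / a - 1 / b) ^ 2 := by
        field_simp
        ring
      have h2 : 0 ≤ (1 + t ^ 2) / r * (r / a - 1 / b) ^ 2 := by positivity
      linarith
    have := mul_nonneg e2 h.nonneg
    linarith
  have hCC : C ^ 2 ≤ A * B := by
    rcases hC0.eq_or_lt with h0 | h0
    · rw [← h0, zero_pow two_ne_zero]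
      exact (mul_pos hA0 hB0).le
    · have h1 := key (C / A) (by positivity)
      have h2 : C / A * A = C := by field_simp
      have h3 : (C / A)⁻¹ * B * C = A * B := by field_simp
      nlinarith
  have hn := h.norm_sub_le z w
  rw [← hC] at hn
  rw [hzi, hwi, div_le_div_iff₀ (by positivity) (by positivity)]
  calc ‖(f z : ℂ) - f w‖ ^ 2 * (z.im * w.im)
      ≤ (‖(z : ℂ) - w‖ * C) ^ 2 * (z.im * w.im) := by gcongr
    _ = ‖(z : ℂ) - w‖ ^ 2 * (z.im * w.im) * C ^ 2 := by ring
    _ ≤ ‖(z : ℂ) - w‖ ^ 2 * (z.im * w.im) * (A * B) := by gcongr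
    _ = _ := by ring

lemma schwarzPick_iterate (h : IsHerglotzRepresentation f α β μ) (z w : ℍ) (n : ℕ) :
    ‖((f^[n] z : ℍ) : ℂ) - (f^[n] w : ℍ)‖ ^ 2 / ((f^[n] z).im * (f^[n] w).im) ≤
      ‖(z : ℂ) - w‖ ^ 2 / (z.im * w.im) := by
  induction n with
  | zero => simp
  | succ n ih =>
    rw [Function.iterate_succ_apply', Function.iterate_succ_apply']
    exact (h.schwarzPick _ _).trans ih

/-- On the imaginary axis the real part of `f z / z` is `α` plus the kernel integral; at height at
least `1` the kernel is bounded by `1`, and it tends to `0` pointwise as the height grows. -/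
lemma linear_coeff_eq_one (h : IsHerglotzRepresentation f α β μ)
    (hlim : HasAngularLimitAtInfty (fun z : ℍ => (f z : ℂ) / (z : ℂ)) 1) : α = 1 := by
  have := h.finite
  set u : ℕ → ℍ := fun n => ⟨((n : ℝ) + 1 : ℝ) * Complex.I, by
    simp; positivity⟩ with hu
  have hre : ∀ n, (u n).re = 0 := fun n => by
    simp [hu, ← UpperHalfPlane.coe_re]
  have him : ∀ n, (u n).im = n + 1 := fun n => by
    simp [hu, ← UpperHalfPlane.coe_im]
  have hcoe : ∀ n, (u n : ℂ) = ((n : ℝ) + 1 : ℝ) * Complex.I := fun n => rfl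
  have htop : Tendsto (fun n : ℕ => (n : ℝ) + 1) atTop atTop :=
    tendsto_atTop_add_const_right _ _ tendsto_natCast_atTop_atTop
  have h1 : Tendsto (fun n => (f (u n) : ℂ) / (u n : ℂ)) atTop (𝓝 1) := by
    refine (hlim 0).comp (tendsto_inf.2 ⟨tendsto_comap_iff.2 ?_, tendsto_principal.2 ?_⟩)
    · refine htop.congr fun n => ?_
      simp only [Function.comp, hcoe]
      rw [norm_mul, Complex.norm_real, Complex.norm_I, mul_one,
        Real.norm_of_nonneg (by positivity)]
    · exact Eventually.of_forall fun n => by simp [hre]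
  have h2 : ∀ n, ((f (u n) : ℂ) / (u n : ℂ)).re = α + ∫ t, herglotzKernel (u n) t ∂μ := fun n => by
    have h3 := h.im_eq (u n)
    rw [him] at h3
    have hn : ((n : ℝ) + 1) ≠ 0 := by positivity
    rw [Complex.div_re, hcoe, Complex.normSq_apply]
    simp only [Complex.re_ofReal_mul, Complex.im_ofReal_mul, Complex.I_re, Complex.I_im,
      UpperHalfPlane.coe_im, h3]
    field_simp
    ring
  have h4 : Tendsto (fun n => ∫ t, herglotzKernel (u n) t ∂μ) atTop (𝓝 (∫ _, (0 : ℝ) ∂μ)) := by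
    refine tendsto_integral_of_dominated_convergence (fun _ => 1)
      (fun n => (continuous_herglotzKernel _).aestronglyMeasurable) (integrable_const _)
      (fun n => Eventually.of_forall fun t => ?_) (Eventually.of_forall fun t => ?_)
    · rw [Real.norm_of_nonneg (herglotzKernel_nonneg _ _), herglotzKernel, hre, him,
        div_le_one (by positivity)]
      have : (0 : ℝ) ≤ n := n.cast_nonneg
      nlinarith
    · simp only [herglotzKernel, hre, him]
      refine Tendsto.div_atTop tendsto_const_nhds (tendsto_atTop_add_const_left _ _ ?_)
      exact (tendsto_pow_atTop two_ne_zero).comp htop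
  have h5 := (Complex.continuous_re.tendsto _).comp h1
  simp only [Function.comp_def, h2, Complex.one_re] at h5
  have h6 := h4.const_add α
  simp only [integral_zero, add_zero] at h6
  exact tendsto_nhds_unique h6 h5

end IsHerglotzRepresentation

/-! ### Real-variable estimates and integrability. -/

/-- A real sequence with bounded steps whose absolute values tend to infinity has a limit sign. -/
lemma exists_sign_tendsto_atTop {x : ℕ → ℝ} {C : ℝ} (hC : ∀ n, |x (n + 1) - x n| ≤ C)
    (hx : Tendsto (fun n => |x n|) atTop atTop) :
    ∃ ε : ℝ, (ε = 1 ∨ ε = -1) ∧ Tendsto (fun n => ε * x n) atTop atTop := by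
  -- Past `N` the modulus exceeds the step size, so no step can change the sign.
  obtain ⟨N, hN⟩ := eventually_atTop.1 (hx.eventually_gt_atTop C)
  have main : ∀ y : ℕ → ℝ, (∀ n, |y (n + 1) - y n| ≤ C) → (∀ n, |y n| = |x n|) → 0 ≤ y N →
      Tendsto y atTop atTop := fun y hy hyx h0 => by
    have hpos : ∀ n, N ≤ n → 0 ≤ y n := fun n hn => by
      induction n, hn using Nat.le_induction with
      | base => exact h0
      | succ n hn ih =>
        have h1 := hN n hn
        rw [← hyx, abs_of_nonneg ih] at h1
        linarith [(abs_le.1 (hy n)).1]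
    refine hx.congr' ?_
    filter_upwards [eventually_ge_atTop N] with n hn
    rw [← hyx, abs_of_nonneg (hpos n hn)]
  rcases le_total 0 (x N) with h | h
  · exact ⟨1, Or.inl rfl, main _ (by simpa using hC) (by simp) (by simpa using h)⟩
  · refine ⟨-1, Or.inr rfl, main _ (fun n => ?_) (by simp) (by linarith)⟩
    rw [← mul_sub, abs_mul]
    simpa using hC n

/-- The Poisson-type sums along a sequence with bounded steps that tends to `+∞` dominate `|s|`,
and `s²` on the positive half-line. -/
lemma exists_le_sum_kernel {u : ℕ → ℝ} {C Y : ℝ} (hY : 0 < Y) (hC : ∀ n, |u (n + 1) - u n| ≤ C)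
    (hu : Tendsto u atTop atTop) :
    ∃ A B : ℝ, 0 ≤ B ∧ ∀ s : ℝ, ∃ N : ℕ, |s| + max s 0 ^ 2 ≤
      A + B * ∑ n ∈ Finset.range N, (1 + s ^ 2) / ((s - u n) ^ 2 + Y ^ 2) := by
  have hC0 : 0 ≤ C := (abs_nonneg _).trans (hC 0)
  set D := C + 1 with hD
  have hD0 : 0 < D := by linarith
  -- Beyond `T`, `|s|` dominates the starting point, the height and two steps; below it the constant
  -- `A` suffices.
  set T := |u 0| + |Y| + 2 * D with hT
  have hT0 : 0 ≤ T := by positivity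
  refine ⟨T + T ^ 2, 40 * D + (D ^ 2 + Y ^ 2), by positivity, fun s => ?_⟩
  have hk : ∀ n, 0 ≤ (1 + s ^ 2) / ((s - u n) ^ 2 + Y ^ 2) := fun n => by positivity
  rcases le_or_gt |s| T with hs | hs
  · refine ⟨0, ?_⟩
    have h1 : max s 0 ≤ T := max_le ((le_abs_self s).trans hs) hT0
    have h2 : max s 0 ^ 2 ≤ T ^ 2 := by gcongr
    simp only [Finset.range_zero, Finset.sum_empty, mul_zero, add_zero]
    linarith
  have hu0 : u 0 < |s| := by
    linarith [le_abs_self (u 0), abs_nonneg Y]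
  have hYs : |Y| ≤ |s| := by linarith [abs_nonneg (u 0)]
  have hDs : 2 * D ≤ |s| := by linarith [abs_nonneg (u 0), abs_nonneg Y]
  have hs0 : 0 < |s| := by linarith
  have hex : ∀ R : ℝ, ∃ n, R < u n := fun R => (hu.eventually_gt_atTop R).exists
  -- the linear lower bound
  have hlin : ∃ N, |s| ≤ 40 * D * ∑ n ∈ Finset.range N, (1 + s ^ 2) / ((s - u n) ^ 2 + Y ^ 2) := by
    classical
    set m := Nat.find (hex (2 * |s|)) with hm
    have hm1 : 2 * |s| < u m := Nat.find_spec (hex (2 * |s|))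
    have hm2 : ∀ n < m, u n ≤ 2 * |s| := fun n hn => not_lt.1 (Nat.find_min (hex (2 * |s|)) hn)
    have hstep : ∀ j, j ≤ m → u m - j * D ≤ u (m - j) := fun j => by
      induction j with
      | zero => simp
      | succ j ih =>
        intro hj
        have h1 := ih (by omega)
        have h2 := (abs_le.1 (hC (m - (j + 1)))).2
        rw [show m - (j + 1) + 1 = m - j by omega] at h2
        push_cast
        linarith
    -- The last `J` indices before `u` first exceeds `2|s|` have values in `[|s|, 2|s|]`, so each
    -- kernel denominator is at most `9 s² + Y² ≤ 10 s²`.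
    set J := ⌊|s| / D⌋₊ with hJ
    have hJ1 : (J : ℝ) * D ≤ |s| := by
      rw [← le_div_iff₀ hD0]
      exact Nat.floor_le (by positivity)
    have hJ2 : |s| < (J + 1) * D := by
      rw [← div_lt_iff₀ hD0]
      exact Nat.lt_floor_add_one _
    have hmJ : J ≤ m := by
      by_contra hlt
      have h1 := hstep m le_rfl
      have h2 : (m : ℝ) ≤ J := by exact_mod_cast (not_le.1 hlt).le
      have h3 : (m : ℝ) * D ≤ J * D := by gcongr
      simp only [Nat.sub_self] at h1
      linarith
    refine ⟨m, ?_⟩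
    have hle : ∀ n ∈ Finset.Ico (m - J) m, (1 / 10 : ℝ) ≤ (1 + s ^ 2) / ((s - u n) ^ 2 + Y ^ 2) := by
      intro n hn
      rw [Finset.mem_Ico] at hn
      have h1 := hm2 n hn.2
      have h2 := hstep (m - n) (by omega)
      rw [show m - (m - n) = n by omega] at h2
      have h3 : ((m - n : ℕ) : ℝ) ≤ J := by exact_mod_cast (by omega : m - n ≤ J)
      have h4 : ((m - n : ℕ) : ℝ) * D ≤ J * D := by gcongr
      have h5 : |s - u n| ≤ 3 * |s| := by
        rw [abs_le]
        constructor <;> linarith [neg_abs_le s, le_abs_self s]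
      have h6 : (s - u n) ^ 2 ≤ 9 * s ^ 2 := by
        have := pow_le_pow_left₀ (abs_nonneg _) h5 2
        rw [mul_pow, sq_abs, sq_abs] at this
        linarith
      have h7 : Y ^ 2 ≤ s ^ 2 := sq_le_sq.2 hYs
      rw [div_le_div_iff₀ (by norm_num) (by positivity)]
      linarith
    have hsum : (J : ℝ) * (1 / 10) ≤ ∑ n ∈ Finset.range m, (1 + s ^ 2) / ((s - u n) ^ 2 + Y ^ 2) :=
      calc (J : ℝ) * (1 / 10) = ∑ n ∈ Finset.Ico (m - J) m, (1 / 10 : ℝ) := by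
            rw [Finset.sum_const, Nat.card_Ico, Nat.sub_sub_self hmJ, nsmul_eq_mul]
        _ ≤ ∑ n ∈ Finset.Ico (m - J) m, (1 + s ^ 2) / ((s - u n) ^ 2 + Y ^ 2) :=
            Finset.sum_le_sum hle
        _ ≤ _ := Finset.sum_le_sum_of_subset_of_nonneg
            (fun n hn => Finset.mem_range.2 (Finset.mem_Ico.1 hn).2) fun n _ _ => hk n
    have h1 := mul_le_mul_of_nonneg_left hsum (by positivity : (0 : ℝ) ≤ 40 * D)
    nlinarith
  -- the quadratic lower bound
  have hquad : ∃ N, max s 0 ^ 2 ≤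
      (D ^ 2 + Y ^ 2) * ∑ n ∈ Finset.range N, (1 + s ^ 2) / ((s - u n) ^ 2 + Y ^ 2) := by
    rcases le_or_gt s 0 with h0 | h0
    · exact ⟨0, by simp [max_eq_right h0]⟩
    classical
    set m := Nat.find (hex s) with hm
    have hm1 : s < u m := Nat.find_spec (hex s)
    have hm0 : m ≠ 0 := fun h => by
      rw [h] at hm1
      rw [abs_of_pos h0] at hu0
      linarith
    -- The step from `m - 1` to `m` jumps over `s`, so `u (m - 1)` lies within `D` of `s` and this
    -- single term suffices.
    have hm2 : u (m - 1) ≤ s := not_lt.1 (Nat.find_min (hex s) (by omega))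
    have h2 := (abs_le.1 (hC (m - 1))).2
    rw [show m - 1 + 1 = m by omega] at h2
    refine ⟨m, ?_⟩
    have h3 : (s - u (m - 1)) ^ 2 ≤ D ^ 2 :=
      pow_le_pow_left₀ (by linarith) (by linarith) 2
    have h4 : (1 + s ^ 2) / ((s - u (m - 1)) ^ 2 + Y ^ 2) ≤
        ∑ n ∈ Finset.range m, (1 + s ^ 2) / ((s - u n) ^ 2 + Y ^ 2) :=
      Finset.single_le_sum (f := fun n => (1 + s ^ 2) / ((s - u n) ^ 2 + Y ^ 2))
        (fun n _ => hk n) (Finset.mem_range.2 (by omega))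
    rw [max_eq_left h0.le]
    calc s ^ 2 ≤ 1 + s ^ 2 := by linarith
      _ = ((s - u (m - 1)) ^ 2 + Y ^ 2) * ((1 + s ^ 2) / ((s - u (m - 1)) ^ 2 + Y ^ 2)) := by
          field_simp
      _ ≤ (D ^ 2 + Y ^ 2) * ((1 + s ^ 2) / ((s - u (m - 1)) ^ 2 + Y ^ 2)) := by gcongr
      _ ≤ _ := by gcongr
  obtain ⟨N₁, h₁⟩ := hlin
  obtain ⟨N₂, h₂⟩ := hquad
  refine ⟨max N₁ N₂, ?_⟩
  have hmono : ∀ N ≤ max N₁ N₂, ∑ n ∈ Finset.range N, (1 + s ^ 2) / ((s - u n) ^ 2 + Y ^ 2) ≤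
      ∑ n ∈ Finset.range (max N₁ N₂), (1 + s ^ 2) / ((s - u n) ^ 2 + Y ^ 2) := fun N hN =>
    Finset.sum_le_sum_of_subset_of_nonneg (Finset.range_subset_range.2 hN) fun n _ _ => hk n
  have h3 := mul_le_mul_of_nonneg_left (hmono N₁ (le_max_left _ _)) (by positivity : 0 ≤ 40 * D)
  have h4 := mul_le_mul_of_nonneg_left (hmono N₂ (le_max_right _ _))
    (by positivity : 0 ≤ D ^ 2 + Y ^ 2)
  nlinarith [sq_nonneg T]

/-- A nonnegative function dominated pointwise by partial sums of a series of nonnegative functions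
whose integrals are summable is integrable. -/
lemma integrable_of_le_sum {μ : Measure ℝ} [IsFiniteMeasure μ] {h : ℝ → ℝ} {k : ℕ → ℝ → ℝ}
    {A B S : ℝ} (hm : Continuous h) (h0 : ∀ t, 0 ≤ h t) (hB : 0 ≤ B) (hk0 : ∀ n t, 0 ≤ k n t)
    (hki : ∀ n, Integrable (k n) μ) (hS : ∀ N, ∑ n ∈ Finset.range N, ∫ t, k n t ∂μ ≤ S)
    (hle : ∀ t, ∃ N, h t ≤ A + B * ∑ n ∈ Finset.range N, k n t) : Integrable h μ := by
  refine ⟨hm.aestronglyMeasurable, ?_⟩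
  rw [hasFiniteIntegral_iff_ofReal (Eventually.of_forall h0)]
  have h1 : ∀ t, ENNReal.ofReal (h t) ≤
      ENNReal.ofReal A + ENNReal.ofReal B * ∑' n, ENNReal.ofReal (k n t) := fun t => by
    obtain ⟨N, hN⟩ := hle t
    calc ENNReal.ofReal (h t) ≤ ENNReal.ofReal (A + B * ∑ n ∈ Finset.range N, k n t) :=
          ENNReal.ofReal_le_ofReal hN
      _ ≤ ENNReal.ofReal A + ENNReal.ofReal (B * ∑ n ∈ Finset.range N, k n t) :=
          ENNReal.ofReal_add_le
      _ = ENNReal.ofReal A + ENNReal.ofReal B * ∑ n ∈ Finset.range N, ENNReal.ofReal (k n t) := by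
          rw [ENNReal.ofReal_mul hB, ENNReal.ofReal_sum_of_nonneg fun n _ => hk0 n t]
      _ ≤ _ := by
          gcongr
          exact ENNReal.sum_le_tsum _
  have hmeas : ∀ n, AEMeasurable (fun t => ENNReal.ofReal (k n t)) μ := fun n =>
    (hki n).aestronglyMeasurable.aemeasurable.ennreal_ofReal
  have h2 : ∫⁻ t, ∑' n, ENNReal.ofReal (k n t) ∂μ ≤ ENNReal.ofReal S := by
    rw [lintegral_tsum hmeas]
    refine ENNReal.tsum_le_of_sum_range_le fun N => ?_
    have h3 : ∀ n, ∫⁻ t, ENNReal.ofReal (k n t) ∂μ = ENNReal.ofReal (∫ t, k n t ∂μ) := fun n =>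
      (ofReal_integral_eq_lintegral_ofReal (hki n) (Eventually.of_forall (hk0 n))).symm
    simp_rw [h3]
    rw [← ENNReal.ofReal_sum_of_nonneg fun n _ => integral_nonneg (hk0 n)]
    exact ENNReal.ofReal_le_ofReal (hS N)
  calc ∫⁻ t, ENNReal.ofReal (h t) ∂μ
      ≤ ∫⁻ t, (ENNReal.ofReal A + ENNReal.ofReal B * ∑' n, ENNReal.ofReal (k n t)) ∂μ :=
        lintegral_mono h1
    _ = ENNReal.ofReal A * μ Set.univ +
        ENNReal.ofReal B * ∫⁻ t, ∑' n, ENNReal.ofReal (k n t) ∂μ := by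
        rw [lintegral_add_left measurable_const, lintegral_const,
          lintegral_const_mul' _ _ ENNReal.ofReal_ne_top]
    _ ≤ ENNReal.ofReal A * μ Set.univ + ENNReal.ofReal B * ENNReal.ofReal S := by gcongr
    _ < ⊤ := ENNReal.add_lt_top.2 ⟨ENNReal.mul_lt_top ENNReal.ofReal_lt_top (measure_lt_top _ _),
        ENNReal.mul_lt_top ENNReal.ofReal_lt_top ENNReal.ofReal_lt_top⟩

/-! ### Limit of the Herglotz integral. -/

/-- If `|t|` and the square of the positive part of `±t` are integrable, then
`∫ (1 + t z) / (t - z) dμ(t)` tends to `-∫ t dμ(t)` as `Re z → ±∞` with `Im z` bounded below. -/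
lemma tendsto_herglotz_integral {μ : Measure ℝ} [IsFiniteMeasure μ] {ε c : ℝ} {z : ℕ → ℍ}
    (hε : ε = 1 ∨ ε = -1) (hc : 0 < c) (him : ∀ n, c ≤ (z n).im)
    (hre : Tendsto (fun n => ε * (z n).re) atTop atTop)
    (hint : Integrable (fun t : ℝ => |ε * t| + max (ε * t) 0 ^ 2) μ)
    (hint' : Integrable (fun t : ℝ => t) μ) :
    Tendsto (fun n => ∫ t : ℝ, (1 + (t : ℂ) * (z n : ℂ)) / ((t : ℂ) - (z n : ℂ)) ∂μ) atTop
      (𝓝 ((-∫ t : ℝ, t ∂μ : ℝ) : ℂ)) := by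
  have hε1 : |ε| = 1 := by rcases hε with rfl | rfl <;> simp
  have hε2 : ε * ε = 1 := by rcases hε with rfl | rfl <;> norm_num
  have hlow : ∀ n t, |ε * t - ε * (z n).re| ≤ ‖(t : ℂ) - z n‖ := fun n t => by
    rw [← mul_sub, abs_mul, hε1, one_mul]
    simpa using Complex.abs_re_le_norm ((t : ℂ) - z n)
  have key : Tendsto (fun n => ∫ t : ℝ, (1 + (t : ℂ) ^ 2) / ((t : ℂ) - (z n : ℂ)) ∂μ) atTop
      (𝓝 (∫ _ : ℝ, (0 : ℂ) ∂μ)) := by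
    refine tendsto_integral_filter_of_dominated_convergence
      (fun t => (1 + c⁻¹) * (1 + (|ε * t| + max (ε * t) 0 ^ 2)))
      (Eventually.of_forall fun n => (Continuous.div (by fun_prop) (by fun_prop)
        fun t => ofReal_sub_ne_zero (z n) t).aestronglyMeasurable) ?_
      (((integrable_const _).add hint).const_mul _) (Eventually.of_forall fun t => ?_)
    · filter_upwards [hre.eventually_ge_atTop 0] with n hn
      refine Eventually.of_forall fun t => ?_
      have h1 : ‖1 + (t : ℂ) ^ 2‖ = 1 + (ε * t) ^ 2 := by
        have : (1 + (t : ℂ) ^ 2) = ((1 + t ^ 2 : ℝ) : ℂ) := by push_cast; rfl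
        rw [this, Complex.norm_real, Real.norm_of_nonneg (by positivity)]
        linear_combination (-t ^ 2) * hε2
      have h2 : c ≤ ‖(t : ℂ) - z n‖ := (him n).trans (im_le_norm_ofReal_sub _ _)
      have h3 := hlow n t
      rw [norm_div, h1]
      set s := ε * t
      have hc' : 0 < c⁻¹ := inv_pos.2 hc
      have hcc : c⁻¹ * c = 1 := inv_mul_cancel₀ hc.ne'
      rw [div_le_iff₀ (hc.trans_le h2)]
      -- On the side to which `z n` escapes, only `|t - z n| ≥ c` is available, which costs `s²`; on
      -- the other side `|t - z n| ≥ |s|` leaves a linear bound.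
      rcases le_total 0 s with hs | hs
      · rw [max_eq_left hs, abs_of_nonneg hs]
        have h4 : 0 ≤ c⁻¹ * (1 + s ^ 2) := by positivity
        calc 1 + s ^ 2 = c⁻¹ * (1 + s ^ 2) * c := by linear_combination (-(1 + s ^ 2)) * hcc
          _ ≤ c⁻¹ * (1 + s ^ 2) * ‖(t : ℂ) - z n‖ := by gcongr
          _ ≤ _ := by
            gcongr
            · linarith
            · linarith
      · rw [max_eq_right hs]
        have h5 : |s| ≤ ‖(t : ℂ) - z n‖ := by
          refine le_trans ?_ h3
          rw [abs_of_nonpos hs, abs_of_nonpos (by linarith)]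
          linarith
        calc 1 + s ^ 2 = c⁻¹ * c + |s| * |s| := by rw [hcc, ← sq, sq_abs]
          _ ≤ c⁻¹ * ‖(t : ℂ) - z n‖ + |s| * ‖(t : ℂ) - z n‖ := by gcongr
          _ = (c⁻¹ + |s|) * ‖(t : ℂ) - z n‖ := by ring
          _ ≤ _ := by
            gcongr
            have : 0 ≤ c⁻¹ * |s| := by positivity
            nlinarith
    · have h4 : Tendsto (fun n => ‖(t : ℂ) - z n‖) atTop atTop := by
        refine tendsto_atTop_mono (fun n => ?_) (tendsto_atTop_add_const_right _ (-(ε * t)) hre)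
        refine le_trans ?_ (hlow n t)
        rw [abs_sub_comm]
        exact le_abs_self _
      rw [tendsto_zero_iff_norm_tendsto_zero]
      simp_rw [norm_div]
      exact tendsto_const_nhds.div_atTop h4
  have hsplit : ∀ n, ∫ t : ℝ, (1 + (t : ℂ) * (z n : ℂ)) / ((t : ℂ) - (z n : ℂ)) ∂μ =
      ((-∫ t : ℝ, t ∂μ : ℝ) : ℂ) + ∫ t : ℝ, (1 + (t : ℂ) ^ 2) / ((t : ℂ) - (z n : ℂ)) ∂μ :=
    fun n => by
    have h1 : ∀ t : ℝ, (1 + (t : ℂ) ^ 2) / ((t : ℂ) - (z n : ℂ)) =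
        (1 + (t : ℂ) * (z n : ℂ)) / ((t : ℂ) - (z n : ℂ)) + (t : ℂ) := fun t => by
      have := ofReal_sub_ne_zero (z n) t
      field_simp
      ring
    simp_rw [h1]
    have h2 : Integrable (fun t : ℝ => (t : ℂ)) μ := hint'.ofReal
    rw [integral_add (integrable_herglotz_integrand (z n) μ) h2, integral_complex_ofReal]
    push_cast
    ring
  simp_rw [hsplit]
  simpa using key.const_add ((-∫ t : ℝ, t ∂μ : ℝ) : ℂ)

/-! ### Orbits of bounded height. -/

section Orbits

variable {f : ℍ → ℍ} {β : ℝ} {μ : Measure ℝ}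

lemma le_im_iterate (h : IsHerglotzRepresentation f 1 β μ) (z : ℍ) (n : ℕ) :
    z.im ≤ (f^[n] z).im := by
  induction n with
  | zero => simp
  | succ n ih =>
    rw [Function.iterate_succ_apply', h.im_eq]
    have h1 : 0 ≤ ∫ t, herglotzKernel (f^[n] z) t ∂μ := integral_nonneg (herglotzKernel_nonneg _)
    nlinarith [(f^[n] z).im_pos]

/-- Telescoping: each step raises the height by the current height, at least `z.im`, times the
kernel integral. -/
lemma sum_integral_kernel_le (h : IsHerglotzRepresentation f 1 β μ) (z : ℍ) (N : ℕ) :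
    z.im * ∑ n ∈ Finset.range N, ∫ t, herglotzKernel (f^[n] z) t ∂μ ≤ (f^[N] z).im - z.im := by
  induction N with
  | zero => simp
  | succ n ih =>
    rw [Function.iterate_succ_apply', h.im_eq, Finset.sum_range_succ]
    have h1 : 0 ≤ ∫ t, herglotzKernel (f^[n] z) t ∂μ := integral_nonneg (herglotzKernel_nonneg _)
    nlinarith [le_im_iterate h z n]

/-- An orbit stays at bounded distance from an orbit with bounded imaginary parts. -/
lemma norm_iterate_sub_le (h : IsHerglotzRepresentation f 1 β μ) {z w : ℍ} {Y q : ℝ}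
    (hY : ∀ n, (f^[n] w).im ≤ Y) (hq : ‖(z : ℂ) - w‖ ^ 2 / (z.im * w.im) ≤ q) (n : ℕ) :
    ‖((f^[n] z : ℍ) : ℂ) - (f^[n] w : ℍ)‖ ≤ (q + 1) * Y := by
  have hz := (f^[n] z).im_pos
  have hw := (f^[n] w).im_pos
  have h1 := (h.schwarzPick_iterate z w n).trans hq
  rw [div_le_iff₀ (mul_pos hz hw)] at h1
  have h2 : (f^[n] z).im ≤ Y + ‖((f^[n] z : ℍ) : ℂ) - (f^[n] w : ℍ)‖ := by
    have := (le_abs_self _).trans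
      (Complex.abs_im_le_norm (((f^[n] z : ℍ) : ℂ) - (f^[n] w : ℍ)))
    simp only [Complex.sub_im, UpperHalfPlane.coe_im] at this
    linarith [hY n]
  set r := ‖((f^[n] z : ℍ) : ℂ) - (f^[n] w : ℍ)‖ with hr
  have hr0 : 0 ≤ r := norm_nonneg _
  have hY0 : 0 < Y := hw.trans_le (hY n)
  have hq0 : 0 ≤ q := by
    refine le_trans ?_ hq
    have := z.im_pos
    have := w.im_pos
    positivity
  have h3 : r ^ 2 ≤ q * ((Y + r) * Y) := h1.trans (by gcongr; exact hY n)
  -- If `r > (q + 1) Y`, then `r² > q Y r + Y r > q Y r + q Y²`, against `h3`.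
  by_contra! hlt
  have h4 : (q + 1) * Y * r < r * r := mul_lt_mul_of_pos_right hlt (lt_of_le_of_lt (by positivity) hlt)
  have h5 : Y * ((q + 1) * Y) < Y * r := mul_lt_mul_of_pos_left hlt hY0
  nlinarith [mul_pos hY0 hY0]

/-- Along an orbit with bounded imaginary parts that escapes to infinity, `f z - z` converges. -/
lemma integrable_and_tendsto_sub (h : IsHerglotzRepresentation f 1 β μ) {w : ℍ} {Y : ℝ}
    (hY : ∀ n, (f^[n] w).im ≤ Y)
    (hinf : Tendsto (fun n => ‖((f^[n] w : ℍ) : ℂ)‖) atTop atTop) :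
    Integrable (fun t : ℝ => t) μ ∧
      Tendsto (fun n => ((f^[n + 1] w : ℍ) : ℂ) - (f^[n] w : ℍ)) atTop
        (𝓝 ((β - ∫ t : ℝ, t ∂μ : ℝ) : ℂ)) := by
  have := h.finite
  have hw := w.im_pos
  have hY0 : 0 < Y := (f^[0] w).im_pos.trans_le (hY 0)
  -- The orbits of `f w` and `w` stay at bounded distance, and the former is the latter shifted by
  -- one.
  have hstep : ∀ n, |(f^[n + 1] w).re - (f^[n] w).re| ≤
      (‖((f w : ℍ) : ℂ) - w‖ ^ 2 / ((f w).im * w.im) + 1) * Y := fun n => by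
    have h1 := norm_iterate_sub_le h (z := f w) hY le_rfl n
    rw [← Function.iterate_succ_apply] at h1
    refine le_trans ?_ h1
    simpa using Complex.abs_re_le_norm (((f^[n + 1] w : ℍ) : ℂ) - (f^[n] w : ℍ))
  have habs : Tendsto (fun n => |(f^[n] w).re|) atTop atTop := by
    refine tendsto_atTop_mono (fun n => ?_) (tendsto_atTop_add_const_right _ (-Y) hinf)
    have h1 := Complex.norm_le_abs_re_add_abs_im ((f^[n] w : ℍ) : ℂ)
    simp only [UpperHalfPlane.coe_re, UpperHalfPlane.coe_im, abs_of_pos (f^[n] w).im_pos] at h1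
    linarith [hY n]
  obtain ⟨ε, hε, hre⟩ := exists_sign_tendsto_atTop hstep habs
  have hε1 : |ε| = 1 := by rcases hε with rfl | rfl <;> simp
  have hε2 : ε ^ 2 = 1 := by rcases hε with rfl | rfl <;> norm_num
  obtain ⟨A, B, hB, hAB⟩ := exists_le_sum_kernel hY0 (u := fun n => ε * (f^[n] w).re)
    (fun n => by rw [← mul_sub, abs_mul, hε1, one_mul]; exact hstep n) hre
  have hint : Integrable (fun t : ℝ => |ε * t| + max (ε * t) 0 ^ 2) μ := by
    refine integrable_of_le_sum (A := A) (k := fun n => herglotzKernel (f^[n] w)) (S := (Y - w.im) / w.im)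
      (by fun_prop) (fun t => by positivity) hB (fun n => herglotzKernel_nonneg _)
      (fun n => integrable_herglotzKernel _ μ) (fun N => ?_) (fun t => ?_)
    · rw [le_div_iff₀ hw, mul_comm]
      exact (sum_integral_kernel_le h w N).trans (by linarith [hY N])
    · obtain ⟨N, hN⟩ := hAB (ε * t)
      refine ⟨N, hN.trans ?_⟩
      gcongr with n _
      have h1 : (ε * t - ε * (f^[n] w).re) ^ 2 = (t - (f^[n] w).re) ^ 2 := by
        rw [← mul_sub, mul_pow, hε2, one_mul]
      rw [h1, mul_pow, hε2, one_mul, herglotzKernel]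
      have := (f^[n] w).im_pos
      gcongr
      exact hY n
  have hint' : Integrable (fun t : ℝ => t) μ := by
    refine hint.mono continuous_id.aestronglyMeasurable (Eventually.of_forall fun t => ?_)
    rw [Real.norm_eq_abs, Real.norm_of_nonneg (by positivity), abs_mul, hε1, one_mul]
    have : 0 ≤ max (ε * t) 0 ^ 2 := by positivity
    linarith
  refine ⟨hint', ?_⟩
  have h1 := (tendsto_herglotz_integral (z := fun n => f^[n] w) hε hw
    (fun n => le_im_iterate h w n) hre hint hint').const_add (β : ℂ)
  convert h1 using 2 with n
  · rw [Function.iterate_succ_apply', h.formula]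
    push_cast
    ring
  · push_cast
    ring

end Orbits

theorem mainTheorem2 (f : ℍ → ℍ) (hf : IsParabolicAtInfty f) (hshift : IsFiniteShift f)
    (α β : ℝ) (μ : Measure ℝ) (hrep : IsHerglotzRepresentation f α β μ) :
    Integrable (fun t : ℝ => t) μ ∧
      ∀ K : Set ℍ, IsCompact K →
        TendstoUniformlyOn (fun (n : ℕ) (z : ℍ) => ((f^[n] z : ℍ) : ℂ) / (n : ℂ))
          (fun _ => ((β - ∫ t : ℝ, t ∂μ : ℝ) : ℂ)) atTop K := by
  obtain rfl := hrep.linear_coeff_eq_one hf.angularLimit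
  obtain ⟨w, Y, hY⟩ := hshift
  replace hY : ∀ n, (f^[n] w).im ≤ Y := fun n => hY ⟨n, rfl⟩
  have hinf : Tendsto (fun n => ‖((f^[n] w : ℍ) : ℂ)‖) atTop atTop := by
    refine tendsto_atTop.2 fun R => ?_
    filter_upwards [hf.denjoyWolff {w} isCompact_singleton R] with n hn
    exact (hn w rfl).le
  obtain ⟨hint, hlim⟩ := integrable_and_tendsto_sub hrep hY hinf
  refine ⟨hint, fun K hK => ?_⟩
  set b : ℂ := ((β - ∫ t : ℝ, t ∂μ : ℝ) : ℂ)
  have hinv : Tendsto (fun n : ℕ => ((n : ℝ))⁻¹) atTop (𝓝 0) :=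
    tendsto_inv_atTop_zero.comp tendsto_natCast_atTop_atTop
  have hinvC : Tendsto (fun n : ℕ => ((n : ℂ))⁻¹) atTop (𝓝 0) := by
    simpa [Function.comp_def] using (Complex.continuous_ofReal.tendsto 0).comp hinv
  -- The Cesàro means of the increments telescope to `(f^[n] w - w) / n`.
  have hw : Tendsto (fun n : ℕ => ((f^[n] w : ℍ) : ℂ) / (n : ℂ)) atTop (𝓝 b) := by
    have h1 := hlim.cesaro_smul
    have h2 := h1.add (hinvC.mul_const (w : ℂ))
    rw [zero_mul, add_zero] at h2
    refine h2.congr fun n => ?_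
    rw [Finset.sum_range_sub (fun n => ((f^[n] w : ℍ) : ℂ)), Complex.real_smul]
    push_cast
    simp only [Function.iterate_zero, id]
    ring
  obtain ⟨q, hq⟩ : ∃ q, ∀ z ∈ K, ‖(z : ℂ) - w‖ ^ 2 / (z.im * w.im) ≤ q := by
    have hcont : Continuous fun z : ℍ => ‖(z : ℂ) - w‖ ^ 2 / (z.im * w.im) :=
      Continuous.div (by fun_prop) (by fun_prop) fun z => (mul_pos z.im_pos w.im_pos).ne'
    obtain ⟨q, hq⟩ := (hK.image hcont).bddAbove
    exact ⟨q, fun z hz => hq ⟨z, hz, rfl⟩⟩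
  rw [Metric.tendstoUniformlyOn_iff]
  intro δ hδ
  have h1 : Tendsto (fun n : ℕ => ‖b - ((f^[n] w : ℍ) : ℂ) / (n : ℂ)‖ + (q + 1) * Y * (n : ℝ)⁻¹)
      atTop (𝓝 0) := by
    simpa using (hw.const_sub b).norm.add (hinv.const_mul ((q + 1) * Y))
  filter_upwards [h1.eventually_lt_const hδ] with n hn z hz
  refine lt_of_le_of_lt ?_ hn
  rw [dist_eq_norm]
  have h2 : b - ((f^[n] z : ℍ) : ℂ) / (n : ℂ) = (b - ((f^[n] w : ℍ) : ℂ) / (n : ℂ)) -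
      (((f^[n] z : ℍ) : ℂ) - (f^[n] w : ℍ)) / (n : ℂ) := by ring
  rw [h2]
  refine (norm_sub_le _ _).trans ?_
  rw [norm_div _ (n : ℂ), Complex.norm_natCast, div_eq_mul_inv _ (n : ℝ)]
  gcongr
  exact norm_iterate_sub_le hrep hY (hq z hz) n
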